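/- Let $0<\alpha<1$ and $0<\beta\le 1$ with $\alpha\beta>\frac12$, and let $B=(B(t))_{t\in[0,1]}$ be a bifractional Brownian motion with parameters $\alpha,\beta$ on a probability space, i.e. a centred real Gaussian process with covariance $$\mathbb{E}[B(s)B(t)]=R(s,t)=\frac{1}{2^\beta}\left((t^{2\alpha}+s^{2\alpha})^\beta-|t-s|^{2\alpha\beta}\right),\qquad s,t\in[0,1],$$ whose sample paths are almost surely continuous. Let $\mathcal{E}$ be the linear span of the indicator functions $\mathbf{1}_{[0,t]}$, $t\in[0,1]$, with the inner product determined by $\langle \mathbf{1}_{[0,s]},\mathbf{1}_{[0,t]}\rangle_{\mathcal H}=R(s,t)$; let $\mathcal{H}$ be its Hilbert space completion (elements of seminorm zero being identified with $0$), and let $\varphi\mapsto B(\varphi)$ be the Wiener integral, i.e. the linear isometry from $\mathcal{H}$ into $L^2(\mathbb{P})$ that extends $\mathbf{1}_{[0,t]}\mapsto B(t)$. Let $(\varphi_n)_{n\ge1}$ be an orthonormal basis of $\mathcal{H}$. For $\gamma>0$ let $\mathcal{C}^\gamma$ be the space of continuous functions $f$ on $[0,1]$ with $$\|f\|_\gamma=\sup_{x}|f(x)|+\sup_{x\ne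 y}\frac{|f(x)-f(y)|}{|x-y|^\gamma}<\infty .$$ Then, almost surely, for every $\gamma$ with $0<\gamma<\alpha\beta$, the functions $$X_N(t)=\sum_{n=1}^{N}\langle\varphi_n,\mathbf{1}_{[0,t]}\rangle_{\mathcal H}\,B(\varphi_n)\qquad (N\ge1)$$ and the sample path $t\mapsto B(t)$ belong to $\mathcal{C}^\gamma$, and $\|X_N-B\|_\gamma\to0$ as $N\to\infty$. -/

import Mathlib

open MeasureTheory ProbabilityTheory Filter Topology
open scoped unitInterval NNReal ENNReal

/-! ### Bifractional Brownian motion on `[0, 1]` -/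

/-- The covariance kernel
`R(s, t) = 2^{-β} ((t^{2α} + s^{2α})^β - |t - s|^{2αβ})` for `s, t ∈ [0, 1]`. -/
noncomputable def bifractionalKernel (α β : ℝ) : Matrix I I ℝ := fun s t =>
  1 / (2 : ℝ) ^ β *
    (((t : ℝ) ^ (2 * α) + (s : ℝ) ^ (2 * α)) ^ β - |(t : ℝ) - (s : ℝ)| ^ (2 * α * β))

/-- `B` is a bifractional Brownian motion (indexed by `[0, 1]`) with parameters `α`, `β`: a centred
real Gaussian process with covariance function `R`. -/
structure IsBifractionalBrownianMotion {Ω : Type*} [MeasurableSpace Ω] (α β : ℝ)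
    (B : I → Ω → ℝ) (P : Measure Ω) : Prop where
  isGaussianProcess : IsGaussianProcess B P
  centred (t : I) : ∫ ω, B t ω ∂P = 0
  covariance_eq (s t : I) : cov[B s, B t; P] = bifractionalKernel α β s t

/-! ### Step functions and the completion `H` -/

/-- The indicator function `1_{[0, t]}`, as a function on `[0, 1]`. -/
noncomputable def stepFun (t : I) : I → ℝ := (Set.Icc 0 t).indicator 1

theorem stepFun_linearIndependent : LinearIndependent ℝ stepFun := by
  rw [linearIndependent_iff]
  intro c hc
  by_contra hne
  have hs : c.support.Nonempty := Finsupp.support_nonempty_iff.mpr hne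
  set t := c.support.max' hs with ht
  have htm : t ∈ c.support := Finset.max'_mem _ _
  have h := congrFun hc t
  rw [Finsupp.linearCombination_apply, Finsupp.sum, Finset.sum_apply,
    Finset.sum_eq_single t] at h
  · exact (Finsupp.mem_support_iff.mp htm) (by simpa [stepFun] using h)
  · intro s hs' hst
    have hlt : s < t := lt_of_le_of_ne (Finset.le_max' _ _ hs') hst
    have : t ∉ Set.Icc 0 s := fun hmem => absurd hmem.2 (not_le.mpr hlt)
    simp [stepFun, Set.indicator_of_notMem this]
  · intro h'
    exact absurd htm h'

/-- The linear space `E` generated by the indicators `1_{[0, t]}`, `t ∈ [0, 1]`. It is a separate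
type, tagged with the kernel `K` that defines its inner product. -/
def StepSpace (K : Matrix I I ℝ) (_hK : K.PosSemidef) : Type :=
  Submodule.span ℝ (Set.range stepFun)

namespace StepSpace

variable {K : Matrix I I ℝ} {hK : K.PosSemidef}

noncomputable instance : AddCommGroup (StepSpace K hK) :=
  inferInstanceAs (AddCommGroup (Submodule.span ℝ (Set.range stepFun)))

noncomputable instance : Module ℝ (StepSpace K hK) :=
  inferInstanceAs (Module ℝ (Submodule.span ℝ (Set.range stepFun)))

/-- The indicators `1_{[0, t]}` form a linear basis of `E`. -/
noncomputable def basis (K : Matrix I I ℝ) (hK : K.PosSemidef) :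
    Module.Basis I ℝ (StepSpace K hK) :=
  Module.Basis.span stepFun_linearIndependent

/-- The indicator `1_{[0, t]}` as an element of `E`. -/
noncomputable def ind (K : Matrix I I ℝ) (hK : K.PosSemidef) (t : I) : StepSpace K hK :=
  ⟨stepFun t, Submodule.subset_span ⟨t, rfl⟩⟩

theorem basis_apply (t : I) : basis K hK t = ind K hK t :=
  Module.Basis.span_apply stepFun_linearIndependent t

/-- The bilinear form on `E` with `⟨1_{[0, s]}, 1_{[0, t]}⟩ = K s t`. -/
noncomputable def form (K : Matrix I I ℝ) (hK : K.PosSemidef) :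
    StepSpace K hK →ₗ[ℝ] StepSpace K hK →ₗ[ℝ] ℝ :=
  (basis K hK).constr ℝ fun s => (basis K hK).constr ℝ fun t => K s t

theorem form_apply (f g : StepSpace K hK) :
    form K hK f g = ((basis K hK).repr f).sum fun s a =>
      ((basis K hK).repr g).sum fun t b => a * K s t * b := by
  simp only [form, Module.Basis.constr_apply, Finsupp.sum, LinearMap.sum_apply,
    LinearMap.smul_apply, smul_eq_mul, Finset.mul_sum]
  refine Finset.sum_congr rfl fun s _ => Finset.sum_congr rfl fun t _ => ?_
  ring

theorem form_symm (f g : StepSpace K hK) : form K hK f g = form K hK g f := by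
  rw [form_apply, form_apply, Finsupp.sum_comm]
  refine Finsupp.sum_congr fun s _ => Finsupp.sum_congr fun t _ => ?_
  have h : K s t = K t s := by simpa using congrFun (congrFun hK.1 t) s
  rw [← h]
  ring

/-- The (possibly degenerate) inner product on `E`; `inner_ind` below identifies it. -/
noncomputable instance core : PreInnerProductSpace.Core ℝ (StepSpace K hK) where
  inner f g := form K hK f g
  conj_inner_symm f g := by simpa using form_symm g f
  re_inner_nonneg f := by
    have h := hK.2 ((basis K hK).repr f)
    simpa [form_apply] using h
  add_left f g h := by simp
  smul_left f g r := by simp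

noncomputable instance : SeminormedAddCommGroup (StepSpace K hK) :=
  InnerProductSpace.Core.toSeminormedAddCommGroup (𝕜 := ℝ)

noncomputable instance : InnerProductSpace ℝ (StepSpace K hK) := .ofCore core

theorem inner_ind (s t : I) : inner ℝ (ind K hK s) (ind K hK t) = K s t := by
  change form K hK (ind K hK s) (ind K hK t) = K s t
  rw [← basis_apply, ← basis_apply]
  simp [form]

end StepSpace

/-- The Hilbert space `H`: the completion of `E` with respect to the inner product determined by
`⟨1_{[0, s]}, 1_{[0, t]}⟩ = R(s, t)`. -/
abbrev BifractionalHilbert (α β : ℝ) (hR : (bifractionalKernel α β).PosSemidef) : Type :=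
  UniformSpace.Completion (StepSpace (bifractionalKernel α β) hR)

/-- The class of the indicator `1_{[0, t]}` in `H`. -/
noncomputable def BifractionalHilbert.ind {α β : ℝ} (hR : (bifractionalKernel α β).PosSemidef)
    (t : I) : BifractionalHilbert α β hR :=
  ((StepSpace.ind _ hR t : StepSpace (bifractionalKernel α β) hR) : BifractionalHilbert α β hR)

/-! ### The Wiener integral -/

namespace IsBifractionalBrownianMotion

variable {Ω : Type*} [MeasurableSpace Ω] {α β : ℝ} {B : I → Ω → ℝ} {P : Measure Ω}

theorem memLp (hB : IsBifractionalBrownianMotion α β B P) (t : I) : MemLp (B t) 2 P :=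
  ((hB.isGaussianProcess.hasGaussianLaw {t}).eval ⟨t, by simp⟩).memLp_two

theorem inner_toLp (hB : IsBifractionalBrownianMotion α β B P) (s t : I) :
    inner ℝ ((hB.memLp s).toLp (B s)) ((hB.memLp t).toLp (B t)) = bifractionalKernel α β s t := by
  have := hB.isGaussianProcess.isProbabilityMeasure
  rw [← hB.covariance_eq s t, covariance_eq_sub (hB.memLp s) (hB.memLp t), hB.centred s,
    zero_mul, sub_zero, L2.inner_def]
  refine integral_congr_ae ?_
  filter_upwards [(hB.memLp s).coeFn_toLp, (hB.memLp t).coeFn_toLp] with ω h1 h2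
  simp [h1, h2, mul_comm]

/-- The covariance kernel of a process is positive semidefinite. -/
theorem posSemidef (hB : IsBifractionalBrownianMotion α β B P) :
    (bifractionalKernel α β).PosSemidef := by
  refine ⟨?_, fun x => ?_⟩
  · ext s t
    rw [Matrix.conjTranspose_apply, star_trivial, ← hB.inner_toLp, ← hB.inner_toLp,
      real_inner_comm]
  · have h : (x.sum fun s a => x.sum fun t b => star a * bifractionalKernel α β s t * b) =
        inner ℝ (x.sum fun s a => a • (hB.memLp s).toLp (B s))
          (x.sum fun s a => a • (hB.memLp s).toLp (B s)) := by
      simp only [Finsupp.sum, sum_inner, inner_sum, real_inner_smul_left, real_inner_smul_right,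
        hB.inner_toLp, star_trivial]
      rw [Finset.sum_comm]
      refine Finset.sum_congr rfl fun s _ => Finset.sum_congr rfl fun t _ => ?_
      ring
    rw [h]
    exact real_inner_self_nonneg

/-- The Hilbert space `H` attached to the covariance function of `B`. -/
abbrev H (hB : IsBifractionalBrownianMotion α β B P) : Type :=
  BifractionalHilbert α β hB.posSemidef

/-- The element `1_{[0, t]}` of `H`. -/
noncomputable abbrev ind (hB : IsBifractionalBrownianMotion α β B P) (t : I) : hB.H :=
  BifractionalHilbert.ind hB.posSemidef t

/-- The linear map `∑ aᵢ 1_{[0, tᵢ]} ↦ ∑ aᵢ B(tᵢ)` from `E` to `L²(P)`. -/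
noncomputable def stepIntegral (hB : IsBifractionalBrownianMotion α β B P) :
    StepSpace (bifractionalKernel α β) hB.posSemidef →ₗ[ℝ] Lp ℝ 2 P :=
  (StepSpace.basis _ hB.posSemidef).constr ℝ fun t => (hB.memLp t).toLp (B t)

theorem inner_stepIntegral (hB : IsBifractionalBrownianMotion α β B P)
    (f g : StepSpace (bifractionalKernel α β) hB.posSemidef) :
    inner ℝ (hB.stepIntegral f) (hB.stepIntegral g) = inner ℝ f g := by
  change _ = StepSpace.form _ _ f g
  rw [StepSpace.form_apply]
  simp only [stepIntegral, Module.Basis.constr_apply, Finsupp.sum, sum_inner, inner_sum,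
    real_inner_smul_left, real_inner_smul_right, hB.inner_toLp]
  rw [Finset.sum_comm]
  refine Finset.sum_congr rfl fun s _ => Finset.sum_congr rfl fun t _ => ?_
  ring

/-- The map `∑ aᵢ 1_{[0, tᵢ]} ↦ ∑ aᵢ B(tᵢ)` as a linear isometry. -/
noncomputable def stepIsometry (hB : IsBifractionalBrownianMotion α β B P) :
    StepSpace (bifractionalKernel α β) hB.posSemidef →ₗᵢ[ℝ] Lp ℝ 2 P where
  toLinearMap := hB.stepIntegral
  norm_map' f := by
    have h := hB.inner_stepIntegral f f
    rw [real_inner_self_eq_norm_sq, real_inner_self_eq_norm_sq] at h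
    exact (pow_left_inj₀ (norm_nonneg _) (norm_nonneg _) two_ne_zero).mp h

/-- The Wiener integral `φ ↦ B(φ)`: the continuous extension to `H` of the isometry
`1_{[0, t]} ↦ B(t)` with values in `L²(P)`. -/
noncomputable def wienerIntegral (hB : IsBifractionalBrownianMotion α β B P) :
    hB.H →L[ℝ] Lp ℝ 2 P :=
  hB.stepIsometry.toContinuousLinearMap.extend UniformSpace.Completion.toComplL

theorem wienerIntegral_coe (hB : IsBifractionalBrownianMotion α β B P)
    (f : StepSpace (bifractionalKernel α β) hB.posSemidef) :
    hB.wienerIntegral (f : hB.H) = hB.stepIntegral f :=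
  ContinuousLinearMap.extend_eq _ UniformSpace.Completion.denseRange_coe
    (UniformSpace.Completion.isUniformInducing_coe _) f

theorem wienerIntegral_ind (hB : IsBifractionalBrownianMotion α β B P) (t : I) :
    hB.wienerIntegral (hB.ind t) = (hB.memLp t).toLp (B t) := by
  rw [ind, BifractionalHilbert.ind, wienerIntegral_coe, stepIntegral, ← StepSpace.basis_apply,
    Module.Basis.constr_basis]

theorem norm_wienerIntegral (hB : IsBifractionalBrownianMotion α β B P) (φ : hB.H) :
    ‖hB.wienerIntegral φ‖ = ‖φ‖ := by
  refine UniformSpace.Completion.induction_on φ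
    (isClosed_eq (by fun_prop) (by fun_prop)) fun f => ?_
  rw [wienerIntegral_coe, UniformSpace.Completion.norm_coe]
  exact hB.stepIsometry.norm_map f

/-- The partial sum `t ↦ ∑_{n < N} ⟨φₙ, 1_{[0, t]}⟩ B(φₙ)(ω)`. -/
noncomputable def partialSum (hB : IsBifractionalBrownianMotion α β B P) (φ : ℕ → hB.H)
    (N : ℕ) (ω : Ω) (t : I) : ℝ :=
  ∑ n ∈ Finset.range N, inner ℝ (φ n) (hB.ind t) * hB.wienerIntegral (φ n) ω

end IsBifractionalBrownianMotion

/-! ### Hölder spaces on `[0, 1]` -/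

/-- The Hölder space `C^γ([0, 1])`, as a set of functions. -/
def holderSpace (γ : ℝ≥0) : Set (I → ℝ) := {f | Continuous f ∧ MemHolder γ f}

/-- The Hölder norm `sup |f| + sup_{x ≠ y} |f x - f y| / |x - y|^γ`, with values in `[0, ∞]`. -/
noncomputable def holderENorm (γ : ℝ≥0) (f : I → ℝ) : ℝ≥0∞ :=
  (⨆ x, ‖f x‖ₑ) + eHolderNorm γ f

/-- `u N → f` in `C^γ([0, 1])`: all functions belong to the space and `‖u N - f‖_γ → 0`. -/
def TendstoHolder (γ : ℝ≥0) (u : ℕ → I → ℝ) (f : I → ℝ) : Prop :=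
  (∀ N, u N ∈ holderSpace γ) ∧ f ∈ holderSpace γ ∧
    Tendsto (fun N => holderENorm γ (u N - f)) atTop (𝓝 0)

/-!
Let `F_N` be the `σ`-algebra generated by the first `N` variables `B(φₙ)`. The remainder
`B(t) - X_N(t)` is Gaussian and orthogonal to these variables, hence independent of them, so that
`X_N(t) = E[B(t) | F_N]`. Gaussian moments and dyadic chaining give `B` an integrable random
`r`-Hölder constant `K` for every `r < αβ`, and conditioning yields
`|X_N(s) - X_N(t)| ≤ E[K | F_N] |s - t|^r`. Since `E[K | F_N]` converges almost surely (Lévy's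
upward theorem), the functions `X_N` share one `r`-Hölder constant. Together with the almost sure
pointwise convergence on a countable dense set, this gives convergence in every smaller Hölder
exponent by interpolation.
-/

/-! ### Dyadic chaining -/

section Dyadic

/-- The point `k / 2 ^ n` of the unit interval, truncated to `1` for `k ≥ 2 ^ n`. -/
noncomputable def dyadicPoint (n k : ℕ) : I :=
  Set.projIcc 0 1 zero_le_one ((k : ℝ) / 2 ^ n)

/-- The largest point of the grid `2 ^ (-n) ℕ` that does not exceed `t`. -/
noncomputable def dyadicFloor (n : ℕ) (t : I) : I :=
  dyadicPoint n ⌊2 ^ n * (t : ℝ)⌋₊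

theorem coe_dyadicPoint {n k : ℕ} (hk : k ≤ 2 ^ n) : (dyadicPoint n k : ℝ) = k / 2 ^ n := by
  have hk' : (k : ℝ) ≤ 2 ^ n := by exact_mod_cast hk
  rw [dyadicPoint, Set.projIcc_of_mem]
  exact ⟨by positivity, (div_le_one (by positivity)).2 hk'⟩

theorem dyadicPoint_of_two_pow_le {n k : ℕ} (hk : 2 ^ n ≤ k) : dyadicPoint n k = 1 := by
  have hk' : (2 : ℝ) ^ n ≤ k := by exact_mod_cast hk
  exact Set.projIcc_of_right_le _ ((one_le_div (by positivity)).2 hk')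

theorem dyadicPoint_succ_two_mul (n k : ℕ) : dyadicPoint (n + 1) (2 * k) = dyadicPoint n k := by
  have h : ((2 * k : ℕ) : ℝ) / 2 ^ (n + 1) = k / 2 ^ n := by
    push_cast
    rw [pow_succ]
    field_simp
  rw [dyadicPoint, dyadicPoint, h]

theorem edist_dyadicPoint_succ {n k : ℕ} (hk : k < 2 ^ n) :
    edist (dyadicPoint n k) (dyadicPoint n (k + 1)) = (2 : ℝ≥0∞)⁻¹ ^ n := by
  rw [edist_dist, Subtype.dist_eq, Real.dist_eq, coe_dyadicPoint hk.le,
    coe_dyadicPoint (Nat.succ_le_of_lt hk), ← sub_div, Nat.cast_add_one, sub_add_cancel_left,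
    abs_div, abs_neg, abs_one, abs_of_pos (by positivity), one_div, ← inv_pow,
    ENNReal.ofReal_pow (by positivity), ENNReal.ofReal_inv_of_pos two_pos, ENNReal.ofReal_ofNat]

theorem dist_dyadicFloor_le (n : ℕ) (t : I) : dist (dyadicFloor n t) t ≤ (1 / 2) ^ n := by
  have hpow : (0 : ℝ) < 2 ^ n := by positivity
  have hle : ⌊2 ^ n * (t : ℝ)⌋₊ ≤ 2 ^ n := by
    refine Nat.floor_le_of_le ?_
    push_cast
    exact mul_le_of_le_one_right hpow.le t.2.2
  have hlower := Nat.floor_le (mul_nonneg hpow.le t.2.1)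
  have hupper := Nat.lt_floor_add_one (2 ^ n * (t : ℝ))
  rw [Subtype.dist_eq, Real.dist_eq, dyadicFloor, coe_dyadicPoint hle, one_div_pow, abs_le]
  constructor
  · rw [neg_le_sub_iff_le_add, ← add_div, le_div_iff₀ hpow]
    linarith
  · rw [sub_le_iff_le_add, div_le_iff₀ hpow, add_mul, one_div_mul_cancel hpow.ne']
    linarith

theorem tendsto_dyadicFloor (t : I) : Tendsto (fun n => dyadicFloor n t) atTop (𝓝 t) :=
  tendsto_iff_dist_tendsto_zero.2 <| squeeze_zero (fun _ => dist_nonneg)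
    (fun n => dist_dyadicFloor_le n t)
    (tendsto_pow_atTop_nhds_zero_of_lt_one (by norm_num) (by norm_num))

variable {E : Type*} [PseudoMetricSpace E] {f : I → E}

theorem dist_dyadicPoint_le_of_le_add_one {n : ℕ} {C : ℝ}
    (h : ∀ k, dist (f (dyadicPoint n k)) (f (dyadicPoint n (k + 1))) ≤ C) {j k : ℕ}
    (hjk : j ≤ k + 1) (hkj : k ≤ j + 1) :
    dist (f (dyadicPoint n j)) (f (dyadicPoint n k)) ≤ C := by
  obtain rfl | rfl | rfl : j = k ∨ j = k + 1 ∨ k = j + 1 := by lia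
  · simpa using dist_nonneg.trans (h 0)
  · rw [dist_comm]
    exact h k
  · exact h j

theorem dist_dyadicFloor_dyadicFloor_le {n : ℕ} {C : ℝ}
    (h : ∀ k, dist (f (dyadicPoint n k)) (f (dyadicPoint n (k + 1))) ≤ C) {s t : I}
    (hst : dist s t ≤ (1 / 2) ^ n) :
    dist (f (dyadicFloor n s)) (f (dyadicFloor n t)) ≤ C := by
  have hscaled : |2 ^ n * (s : ℝ) - 2 ^ n * t| ≤ 1 := by
    rw [← mul_sub, abs_mul, abs_of_pos (by positivity : (0 : ℝ) < 2 ^ n)]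
    calc (2 : ℝ) ^ n * |(s : ℝ) - t| ≤ 2 ^ n * (1 / 2) ^ n :=
          mul_le_mul_of_nonneg_left hst (by positivity)
      _ = 1 := by rw [← mul_pow]; norm_num
  have hfloor {a b : ℝ} (hab : a ≤ b + 1) (hb : 0 ≤ b) : ⌊a⌋₊ ≤ ⌊b⌋₊ + 1 := by
    rw [← Nat.floor_add_one hb]
    exact Nat.floor_le_floor hab
  obtain ⟨hts, hst⟩ := abs_le.1 hscaled
  exact dist_dyadicPoint_le_of_le_add_one h
    (hfloor (by linarith) (mul_nonneg (by positivity) t.2.1))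
    (hfloor (by linarith) (mul_nonneg (by positivity) s.2.1))

theorem dist_dyadicFloor_succ_le {n : ℕ} {C : ℝ}
    (h : ∀ k, dist (f (dyadicPoint (n + 1) k)) (f (dyadicPoint (n + 1) (k + 1))) ≤ C) (t : I) :
    dist (f (dyadicFloor n t)) (f (dyadicFloor (n + 1) t)) ≤ C := by
  have hlower := Nat.floor_le (mul_nonneg (by positivity : (0 : ℝ) ≤ 2 ^ n) t.2.1)
  have hupper := Nat.lt_floor_add_one (2 ^ n * (t : ℝ))
  rw [dyadicFloor, ← dyadicPoint_succ_two_mul, dyadicFloor, pow_succ, mul_right_comm]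
  refine dist_dyadicPoint_le_of_le_add_one h (Nat.le_succ_of_le (Nat.le_floor ?_))
    (Nat.le_of_lt_succ ((Nat.floor_lt (by linarith)).2 ?_))
  all_goals
    push_cast
    linarith

theorem dist_dyadicFloor_apply_le (hf : Continuous f) {K q : ℝ} (hq : 0 ≤ q) (hq1 : q < 1)
    (h : ∀ n k, dist (f (dyadicPoint n k)) (f (dyadicPoint n (k + 1))) ≤ K * q ^ n)
    (n : ℕ) (t : I) : dist (f (dyadicFloor n t)) (f t) ≤ K * q ^ n / (1 - q) := by
  have hK : 0 ≤ K := by simpa using dist_nonneg.trans (h 0 0)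
  refine dist_le_of_le_geometric_of_tendsto q K hq1 (fun m => ?_)
    ((hf.tendsto t).comp (tendsto_dyadicFloor t)) n
  exact (dist_dyadicFloor_succ_le (h (m + 1)) t).trans
    (mul_le_mul_of_nonneg_left (pow_le_pow_of_le_one hq hq1.le m.le_succ) hK)

theorem dist_le_of_dyadic (hf : Continuous f) {K q : ℝ} (hq : 0 ≤ q) (hq1 : q < 1)
    (h : ∀ n k, dist (f (dyadicPoint n k)) (f (dyadicPoint n (k + 1))) ≤ K * q ^ n)
    {n : ℕ} {s t : I} (hst : dist s t ≤ (1 / 2) ^ n) :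
    dist (f s) (f t) ≤ (1 + 2 / (1 - q)) * K * q ^ n := by
  have hs := dist_dyadicFloor_apply_le hf hq hq1 h n s
  have ht := dist_dyadicFloor_apply_le hf hq hq1 h n t
  rw [dist_comm] at hs
  calc dist (f s) (f t) ≤ dist (f s) (f (dyadicFloor n s)) +
        dist (f (dyadicFloor n s)) (f (dyadicFloor n t)) + dist (f (dyadicFloor n t)) (f t) :=
        dist_triangle4 _ _ _ _
    _ ≤ K * q ^ n / (1 - q) + K * q ^ n + K * q ^ n / (1 - q) :=
        add_le_add (add_le_add hs (dist_dyadicFloor_dyadicFloor_le (h n) hst)) ht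
    _ = (1 + 2 / (1 - q)) * K * q ^ n := by ring

theorem exists_holderWith_of_dyadic (E : Type*) [PseudoMetricSpace E] {r : ℝ≥0} (hr : 0 < r) :
    ∃ C : ℝ≥0, ∀ (f : I → E) (K : ℝ≥0), Continuous f →
      (∀ n, ∀ k < 2 ^ n, nndist (f (dyadicPoint n k)) (f (dyadicPoint n (k + 1))) ≤
        K * ((1 / 2) ^ (r : ℝ)) ^ n) → HolderWith (C * K) r f := by
  set q : ℝ≥0 := (1 / 2) ^ (r : ℝ)
  have hq : 0 < q := NNReal.rpow_pos (by norm_num)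
  have hq1 : q < 1 := NNReal.rpow_lt_one (by norm_num) (by exact_mod_cast hr)
  refine ⟨(1 + 2 / (1 - q)) / q, fun f K hf h s t => ?_⟩
  have hall (n k) : dist (f (dyadicPoint n k)) (f (dyadicPoint n (k + 1))) ≤ K * (q : ℝ) ^ n := by
    rcases lt_or_ge k (2 ^ n) with hk | hk
    · exact_mod_cast h n k hk
    · rw [dyadicPoint_of_two_pow_le hk, dyadicPoint_of_two_pow_le (hk.trans k.le_succ), dist_self]
      positivity
  rcases eq_or_ne s t with rfl | hst
  · simp
  obtain ⟨m, hlt, hle⟩ := exists_nat_pow_near_of_lt_one (dist_pos.2 hst)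
    (Real.dist_le_of_mem_Icc_01 s.2 t.2) (by norm_num : (0 : ℝ) < 1 / 2) (by norm_num)
  have hpow : q ^ (m + 1) ≤ nndist s t ^ (r : ℝ) := by
    rw [← NNReal.rpow_mul_natCast, mul_comm, NNReal.rpow_natCast_mul]
    exact NNReal.rpow_le_rpow (by exact_mod_cast hlt.le) r.2
  rw [edist_nndist, edist_nndist, ← ENNReal.coe_rpow_of_nonneg _ r.coe_nonneg]
  norm_cast
  calc nndist (f s) (f t) ≤ (1 + 2 / (1 - q)) * K * q ^ m := by
        have := dist_le_of_dyadic hf q.2 (by exact_mod_cast hq1) hall hle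
        rw [← NNReal.coe_le_coe]
        push_cast [NNReal.coe_sub hq1.le]
        exact this
    _ = (1 + 2 / (1 - q)) / q * K * q ^ (m + 1) := by
        rw [pow_succ]
        field_simp
    _ ≤ (1 + 2 / (1 - q)) / q * K * nndist s t ^ (r : ℝ) := by gcongr

end Dyadic

/-! ### Convergence in Hölder spaces -/

section HolderConvergence

variable {X Y : Type*} [PseudoMetricSpace X] [PseudoMetricSpace Y] {C r : ℝ≥0} {S : Set X}
  {u : ℕ → X → Y} {f : X → Y}

theorem holderWith_of_dense (hS : Dense S) (hf : Continuous f) (h : HolderOnWith C r f S) :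
    HolderWith C r f := by
  have hclosed : IsClosed {p : X × X | edist (f p.1) (f p.2) ≤ C * edist p.1 p.2 ^ (r : ℝ)} := by
    refine isClosed_le ((hf.comp continuous_fst).edist (hf.comp continuous_snd)) ?_
    exact (ENNReal.continuous_const_mul ENNReal.coe_ne_top).comp
      (ENNReal.continuous_rpow_const.comp continuous_edist)
  exact fun x y => hclosed.closure_subset_iff.2 (fun p hp => h p.1 hp.1 p.2 hp.2)
    ((hS.prod hS) (x, y))

theorem holderWith_of_tendsto_of_dense (hS : Dense S) (hu : ∀ N, HolderWith C r (u N))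
    (hf : Continuous f) (h : ∀ x ∈ S, Tendsto (u · x) atTop (𝓝 (f x))) : HolderWith C r f :=
  holderWith_of_dense hS hf fun x hx y hy =>
    le_of_tendsto ((h x hx).edist (h y hy)) (Eventually.of_forall fun N => hu N x y)

theorem equicontinuous_of_holderWith (hr : 0 < r) (hu : ∀ N, HolderWith C r (u N)) :
    Equicontinuous u := by
  refine Metric.equicontinuous_of_continuity_modulus (fun d => C * d ^ (r : ℝ)) ?_ u
    fun x y N => (hu N).dist_le x y
  have hr' : (0 : ℝ) < r := by exact_mod_cast hr
  have hmodulus : Continuous fun d : ℝ => C * d ^ (r : ℝ) :=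
    continuous_const.mul (Real.continuous_rpow_const hr'.le)
  simpa [Real.zero_rpow hr'.ne'] using hmodulus.tendsto 0

theorem tendstoUniformly_of_holderWith [CompactSpace X] (hS : Dense S) (hr : 0 < r)
    (hu : ∀ N, HolderWith C r (u N)) (hf : Continuous f)
    (h : ∀ x ∈ S, Tendsto (u · x) atTop (𝓝 (f x))) : TendstoUniformly u f atTop := by
  have hequi := equicontinuous_of_holderWith hr hu
  refine UniformFun.tendsto_iff_tendstoUniformly.1
    ((hequi.tendsto_uniformFun_iff_pi atTop f).2 (tendsto_pi_nhds.2 fun x => ?_))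
  exact (hequi.isClosed_setOfPred_tendsto hf).closure_subset_iff.2 h (hS x)

end HolderConvergence

section HolderNorm

variable {C r s : ℝ≥0}

theorem eHolderNorm_le_of_holderWith {X : Type*} [PseudoMetricSpace X] {f : X → ℝ}
    (hf : HolderWith C r f) (hr : 0 < r) (hsr : s ≤ r) {ε : ℝ≥0} (hε : ∀ x, ‖f x‖ₑ ≤ ε) :
    eHolderNorm s f ≤
      (2 * ε : ℝ≥0∞) ^ ((1 - s / r : ℝ≥0) : ℝ) * (C : ℝ≥0∞) ^ ((s / r : ℝ≥0) : ℝ) := by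
  have hbounded : HolderWith (2 * ε) 0 f := by
    intro x y
    calc edist (f x) (f y) = ‖f x - f y‖ₑ := edist_eq_enorm_sub _ _
      _ ≤ ‖f x‖ₑ + ‖f y‖ₑ := enorm_sub_le
      _ ≤ ε + ε := add_le_add (hε x) (hε y)
      _ = _ := by simp [two_mul]
  have h := hbounded.interpolate hf (tsub_add_cancel_of_le (div_le_one_of_le₀ hsr zero_le))
  rw [zero_mul, zero_add, mul_div_cancel₀ _ hr.ne'] at h
  rw [← ENNReal.coe_ofNat, ← ENNReal.coe_mul, ← ENNReal.coe_rpow_of_nonneg _ (NNReal.coe_nonneg _),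
    ← ENNReal.coe_rpow_of_nonneg _ (NNReal.coe_nonneg _), ← ENNReal.coe_mul]
  exact h.eHolderNorm_le

theorem holderENorm_le_of_holderWith {f : I → ℝ} (hf : HolderWith C r f) (hr : 0 < r)
    (hsr : s ≤ r) :
    holderENorm s f ≤ (⨆ x, ‖f x‖ₑ) +
      (2 * ⨆ x, ‖f x‖ₑ) ^ ((1 - s / r : ℝ≥0) : ℝ) * (C : ℝ≥0∞) ^ ((s / r : ℝ≥0) : ℝ) := by
  rcases eq_or_ne (⨆ x, ‖f x‖ₑ) ∞ with htop | hfin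
  · simp [htop]
  · lift ⨆ x, ‖f x‖ₑ to ℝ≥0 using hfin with ε hε
    rw [holderENorm, ← hε]
    gcongr
    exact eHolderNorm_le_of_holderWith hf hr hsr fun x => hε ▸ le_iSup (fun x => ‖f x‖ₑ) x

theorem tendsto_holderENorm_zero {g : ℕ → I → ℝ} (hg : ∀ N, HolderWith C r (g N)) (hr : 0 < r)
    (hsr : s < r) (hunif : TendstoUniformly g 0 atTop) :
    Tendsto (fun N => holderENorm s (g N)) atTop (𝓝 0) := by
  have hsup : Tendsto (fun N => ⨆ x, ‖g N x‖ₑ) atTop (𝓝 0) := by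
    refine ENNReal.tendsto_nhds_zero.2 fun ε hε => ?_
    filter_upwards [EMetric.tendstoUniformly_iff.1 hunif ε hε] with N hN
    exact iSup_le fun x => (edist_zero_left _).symm.trans_le (hN x).le
  have hexp : (0 : ℝ) < (1 - s / r : ℝ≥0) := by
    exact_mod_cast tsub_pos_of_lt ((div_lt_one hr).2 hsr)
  have hpow := (ENNReal.Tendsto.const_mul hsup
    (Or.inr (ENNReal.ofNat_ne_top (n := 2)))).ennrpow_const ((1 - s / r : ℝ≥0) : ℝ)
  have hbound := hsup.add (ENNReal.Tendsto.mul_const hpow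
    (Or.inr (ENNReal.rpow_ne_top_of_nonneg (s / r).coe_nonneg (ENNReal.coe_ne_top (r := C)))))
  rw [mul_zero, ENNReal.zero_rpow_of_pos hexp, zero_mul, add_zero] at hbound
  exact tendsto_of_tendsto_of_tendsto_of_le_of_le tendsto_const_nhds hbound
    (fun _ => zero_le) fun N => holderENorm_le_of_holderWith (hg N) hr hsr.le

theorem tendstoHolder_of_holderWith {u : ℕ → I → ℝ} {f : I → ℝ} {S : Set I} (hS : Dense S)
    (hu : ∀ N, HolderWith C r (u N)) (hsr : s < r) (hf : Continuous f)
    (h : ∀ x ∈ S, Tendsto (u · x) atTop (𝓝 (f x))) : TendstoHolder s u f := by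
  have hr : 0 < r := pos_of_gt hsr
  have hfr : HolderWith C r f := holderWith_of_tendsto_of_dense hS hu hf h
  have hmem {g : I → ℝ} (hg : HolderWith C r g) : g ∈ holderSpace s :=
    ⟨hg.continuous hr, hg.memHolder.of_le hsr.le⟩
  have hsub (N) : HolderWith (C + C) r (u N - f) := by
    rw [sub_eq_add_neg]
    exact (hu N).add fun x y => by simpa using hfr x y
  have hunif : TendstoUniformly (fun N => u N - f) 0 atTop := by
    simpa [EMetric.tendstoUniformly_iff, edist_eq_enorm_sub] using
      tendstoUniformly_of_holderWith hS hr hu hf h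
  exact ⟨fun N => hmem (hu N), hmem hfr, tendsto_holderENorm_zero hsub hr hsr hunif⟩

end HolderNorm

/-! ### Kolmogorov processes -/

section Kolmogorov

/-- A discrete Hölder–Besov functional: the sum of the `p`-th powers of all dyadic increments of
`f`, each weighted by the `r`-th power of the inverse length of the interval. -/
noncomputable def dyadicHolderSum {E : Type*} [PseudoEMetricSpace E] (r p : ℝ) (f : I → E) :
    ℝ≥0∞ :=
  ∑' n : ℕ, ∑ k ∈ Finset.range (2 ^ n),
    (2 ^ (r * n) * edist (f (dyadicPoint n k)) (f (dyadicPoint n (k + 1)))) ^ p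

theorem edist_dyadicPoint_le_dyadicHolderSum {E : Type*} [PseudoEMetricSpace E] {r p : ℝ}
    (hp : 0 < p) (f : I → E) {n k : ℕ} (hk : k < 2 ^ n) :
    edist (f (dyadicPoint n k)) (f (dyadicPoint n (k + 1))) ≤
      dyadicHolderSum r p f ^ p⁻¹ * ((2⁻¹ : ℝ≥0∞) ^ r) ^ n := by
  have hweight : (2 : ℝ≥0∞) ^ (r * n) ≠ 0 := by simp
  have hweight' : (2 : ℝ≥0∞) ^ (r * n) ≠ ∞ := by finiteness
  have hterm : (2 ^ (r * n) * edist (f (dyadicPoint n k)) (f (dyadicPoint n (k + 1)))) ^ p ≤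
      dyadicHolderSum r p f :=
    (Finset.single_le_sum_of_canonicallyOrdered
      (f := fun k => (2 ^ (r * n) * edist (f (dyadicPoint n k)) (f (dyadicPoint n (k + 1)))) ^ p)
      (Finset.mem_range.2 hk)).trans (ENNReal.le_tsum n)
  rw [← ENNReal.le_rpow_inv_iff hp] at hterm
  rw [← ENNReal.rpow_mul_natCast, ENNReal.inv_rpow, ← div_eq_mul_inv,
    ENNReal.le_div_iff_mul_le (Or.inl hweight) (Or.inl hweight'), mul_comm]
  exact hterm

variable {Ω E : Type*} {mΩ : MeasurableSpace Ω} {P : Measure Ω} {p q : ℝ} {M : ℝ≥0}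

theorem aemeasurable_dyadicHolderSum [PseudoEMetricSpace E] {Y : I → Ω → E}
    (hY : IsAEKolmogorovProcess Y P p q M) (r : ℝ) :
    AEMeasurable (fun ω => dyadicHolderSum r p (Y · ω)) P :=
  .tsum fun _ => Finset.aemeasurable_fun_sum _ fun _ _ =>
    (hY.aemeasurable_edist.const_mul _).pow_const p

theorem lintegral_dyadicPoint_increment_le [PseudoEMetricSpace E] {Y : I → Ω → E}
    (hY : IsAEKolmogorovProcess Y P p q M) (r : ℝ) {n k : ℕ} (hk : k < 2 ^ n) :
    ∫⁻ ω, ((2 : ℝ≥0∞) ^ (r * n) *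
        edist (Y (dyadicPoint n k) ω) (Y (dyadicPoint n (k + 1)) ω)) ^ p ∂P ≤
      M * ((2 : ℝ≥0∞) ^ (r * p - q)) ^ n := by
  simp_rw [ENNReal.mul_rpow_of_nonneg _ _ hY.p_pos.le]
  rw [lintegral_const_mul'' _ (hY.aemeasurable_edist.pow_const p)]
  calc ((2 : ℝ≥0∞) ^ (r * n)) ^ p *
        ∫⁻ ω, edist (Y (dyadicPoint n k) ω) (Y (dyadicPoint n (k + 1)) ω) ^ p ∂P
      ≤ ((2 : ℝ≥0∞) ^ (r * n)) ^ p * (M * ((2 : ℝ≥0∞)⁻¹ ^ n) ^ q) := by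
        rw [← edist_dyadicPoint_succ hk]
        gcongr
        exact hY.kolmogorovCondition _ _
    _ = M * ((2 : ℝ≥0∞) ^ (r * p - q)) ^ n := by
        rw [← ENNReal.rpow_mul, ← ENNReal.rpow_natCast_mul, ENNReal.inv_rpow, ← ENNReal.rpow_neg,
          mul_left_comm, ← ENNReal.rpow_add _ _ two_ne_zero ENNReal.ofNat_ne_top,
          ← ENNReal.rpow_mul_natCast]
        ring_nf

theorem lintegral_dyadicHolderSum_ne_top [PseudoEMetricSpace E] {Y : I → Ω → E}
    (hY : IsAEKolmogorovProcess Y P p q M) {r : ℝ} (hr : 1 + r * p < q) :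
    ∫⁻ ω, dyadicHolderSum r p (Y · ω) ∂P ≠ ∞ := by
  have hmeas (n : ℕ) (k : ℕ) : AEMeasurable (fun ω => ((2 : ℝ≥0∞) ^ (r * n) *
      edist (Y (dyadicPoint n k) ω) (Y (dyadicPoint n (k + 1)) ω)) ^ p) P :=
    (hY.aemeasurable_edist.const_mul _).pow_const p
  have hratio : (2 : ℝ≥0∞) ^ (1 + r * p - q) < 1 :=
    ENNReal.rpow_lt_one_of_one_lt_of_neg ENNReal.one_lt_two (by linarith)
  have hbound : ∫⁻ ω, dyadicHolderSum r p (Y · ω) ∂P ≤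
      ∑' n : ℕ, M * ((2 : ℝ≥0∞) ^ (1 + r * p - q)) ^ n := by
    unfold dyadicHolderSum
    rw [lintegral_tsum fun n => Finset.aemeasurable_fun_sum _ fun k _ => hmeas n k]
    refine ENNReal.tsum_le_tsum fun n => ?_
    rw [lintegral_finsetSum' _ fun k _ => hmeas n k]
    refine (Finset.sum_le_card_nsmul _ _ _ fun k hk =>
      lintegral_dyadicPoint_increment_le hY r (Finset.mem_range.1 hk)).trans_eq ?_
    rw [Finset.card_range, nsmul_eq_mul, Nat.cast_pow, Nat.cast_ofNat, mul_left_comm, ← mul_pow,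
      add_sub_assoc, ENNReal.rpow_add _ _ two_ne_zero ENNReal.ofNat_ne_top, ENNReal.rpow_one]
  refine ne_top_of_le_ne_top ?_ hbound
  rw [ENNReal.tsum_mul_left, ENNReal.tsum_geometric]
  exact ENNReal.mul_ne_top ENNReal.coe_ne_top (ENNReal.inv_ne_top.2 (tsub_pos_of_lt hratio).ne')

theorem exists_memLp_holderWith_of_kolmogorov [PseudoMetricSpace E] {Y : I → Ω → E}
    (hY : IsAEKolmogorovProcess Y P p q M) (hcont : ∀ᵐ ω ∂P, Continuous (Y · ω)) {r : ℝ≥0}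
    (hr : 0 < r) (hrpq : 1 + r * p < q) :
    ∃ K : Ω → ℝ≥0, MemLp (fun ω => (K ω : ℝ)) (ENNReal.ofReal p) P ∧
      ∀ᵐ ω ∂P, HolderWith (K ω) r (Y · ω) := by
  obtain ⟨C, hC⟩ := exists_holderWith_of_dyadic E hr
  have hp := hY.p_pos
  set D : Ω → ℝ≥0∞ := fun ω => dyadicHolderSum r p (Y · ω)
  have hDmeas : AEMeasurable D P := aemeasurable_dyadicHolderSum hY r
  have hDint : ∫⁻ ω, D ω ∂P ≠ ∞ := lintegral_dyadicHolderSum_ne_top hY hrpq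
  have hDfin : ∀ᵐ ω ∂P, D ω ≠ ∞ := (ae_lt_top' hDmeas hDint).mono fun _ => LT.lt.ne
  have hDroot : MemLp (fun ω => ((D ω ^ p⁻¹).toNNReal : ℝ)) (ENNReal.ofReal p) P := by
    refine ⟨(hDmeas.pow_const _).ennreal_toNNReal.coe_nnreal_real.aestronglyMeasurable, ?_⟩
    rw [eLpNorm_lt_top_iff_lintegral_rpow_enorm_lt_top (by simpa using hp)
      ENNReal.ofReal_ne_top, ENNReal.toReal_ofReal hp.le]
    refine lt_of_le_of_lt (lintegral_mono fun ω => ?_) hDint.lt_top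
    rw [← ENNReal.le_rpow_inv_iff hp, NNReal.enorm_eq]
    exact ENNReal.coe_toNNReal_le_self
  refine ⟨fun ω => C * (D ω ^ p⁻¹).toNNReal, by simpa using hDroot.const_mul (C : ℝ), ?_⟩
  filter_upwards [hcont, hDfin] with ω hω hD
  refine hC _ _ hω fun n k hk => ?_
  rw [← ENNReal.coe_le_coe, ← edist_nndist, ENNReal.coe_mul,
    ENNReal.coe_toNNReal (ENNReal.rpow_ne_top_of_nonneg (by positivity) hD), ENNReal.coe_pow,
    ENNReal.coe_rpow_of_nonneg _ r.coe_nonneg, one_div, ENNReal.coe_inv two_ne_zero,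
    ENNReal.coe_ofNat]
  exact edist_dyadicPoint_le_dyadicHolderSum hp (Y · ω) hk

end Kolmogorov

/-! ### Conditioning a random Hölder function -/

section CondExp

variable {Ω T E : Type*} {mΩ : MeasurableSpace Ω} {P : Measure Ω} [NormedAddCommGroup E]
  [NormedSpace ℝ E] [CompleteSpace E]

theorem ae_dist_condExp_le {m : MeasurableSpace Ω} {f g : Ω → E} {K : Ω → ℝ} {c : ℝ}
    (hf : Integrable f P) (hg : Integrable g P) (hK : Integrable K P)
    (h : ∀ᵐ ω ∂P, dist (f ω) (g ω) ≤ c * K ω) :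
    ∀ᵐ ω ∂P, dist (P[f | m] ω) (P[g | m] ω) ≤ c * P[K | m] ω := by
  have hmono : P[fun ω => ‖(f - g) ω‖ | m] ≤ᵐ[P] P[c • K | m] := by
    refine condExp_mono (hf.sub hg).norm (hK.smul c) ?_
    filter_upwards [h] with ω hω
    simpa [dist_eq_norm] using hω
  filter_upwards [condExp_sub hf hg m, norm_condExp_le (f - g), hmono, condExp_smul c K m]
    with ω hsub hnorm hmono hsmul
  rw [dist_eq_norm, ← Pi.sub_apply, ← hsub]
  exact (hnorm.trans hmono).trans_eq hsmul

variable [IsFiniteMeasure P] [PseudoMetricSpace T] [TopologicalSpace.SeparableSpace T]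

theorem ae_exists_forall_holderWith_of_condExp {ℱ : Filtration ℕ mΩ} {Y : T → Ω → E}
    {X : ℕ → Ω → T → E} {K : Ω → ℝ≥0} {r : ℝ≥0} (hY : ∀ t, Integrable (Y t) P)
    (hK : Integrable (fun ω => (K ω : ℝ)) P) (hYK : ∀ᵐ ω ∂P, HolderWith (K ω) r (Y · ω))
    (hX : ∀ N t, (X N · t) =ᵐ[P] P[Y t | ℱ N]) (hXcont : ∀ᵐ ω ∂P, ∀ N, Continuous (X N ω)) :
    ∀ᵐ ω ∂P, ∃ C : ℝ≥0, ∀ N, HolderWith C r (X N ω) := by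
  obtain ⟨S, hScount, hSdense⟩ := TopologicalSpace.exists_countable_dense T
  have hdist (s t : T) (N : ℕ) : ∀ᵐ ω ∂P,
      dist (X N ω s) (X N ω t) ≤ dist s t ^ (r : ℝ) * P[fun ω => (K ω : ℝ) | ℱ N] ω := by
    have hst : ∀ᵐ ω ∂P, dist (Y s ω) (Y t ω) ≤ dist s t ^ (r : ℝ) * K ω := by
      filter_upwards [hYK] with ω hω
      rw [mul_comm]
      exact hω.dist_le s t
    filter_upwards [hX N s, hX N t, ae_dist_condExp_le (m := ℱ N) (hY s) (hY t) hK hst]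
      with ω hs ht hω
    rwa [hs, ht]
  have hdistS : ∀ᵐ ω ∂P, ∀ N, ∀ s ∈ S, ∀ t ∈ S,
      dist (X N ω s) (X N ω t) ≤ dist s t ^ (r : ℝ) * P[fun ω => (K ω : ℝ) | ℱ N] ω :=
    ae_all_iff.2 fun N => (ae_ball_iff hScount).2 fun s _ => (ae_ball_iff hScount).2 fun t _ =>
      hdist s t N
  filter_upwards [hXcont, hdistS, tendsto_ae_condExp (ℱ := ℱ) fun ω => (K ω : ℝ)]
    with ω hcont hω hconv
  obtain ⟨C, hC⟩ := hconv.bddAbove_range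
  refine ⟨C.toNNReal, fun N => holderWith_of_dense hSdense (hcont N) fun s hs t ht => ?_⟩
  have hCN : P[fun ω => (K ω : ℝ) | ℱ N] ω ≤ C.toNNReal :=
    (hC ⟨N, rfl⟩).trans (Real.le_coe_toNNReal C)
  have hle : dist (X N ω s) (X N ω t) ≤ C.toNNReal * dist s t ^ (r : ℝ) := by
    rw [mul_comm]
    exact (hω N s hs t ht).trans (by gcongr)
  rw [edist_dist, edist_dist, ENNReal.ofReal_rpow_of_nonneg dist_nonneg r.coe_nonneg,
    ← ENNReal.ofReal_coe_nnreal, ← ENNReal.ofReal_mul (by positivity)]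
  exact ENNReal.ofReal_le_ofReal hle

end CondExp

/-! ### Isonormal Gaussian maps -/

section GaussianLimit

variable {Ω : Type*} {mΩ : MeasurableSpace Ω} {P : Measure Ω}

theorem coeFn_sum_smul_ae_eq {ι E : Type*} [NormedAddCommGroup E] [NormedSpace ℝ E] {p : ℝ≥0∞}
    (s : Finset ι) (c : ι → ℝ) (X : ι → Lp E p P) :
    ⇑(∑ i ∈ s, c i • X i) =ᵐ[P] fun ω => ∑ i ∈ s, c i • X i ω := by
  have hsmul : ∀ᵐ ω ∂P, ∀ i ∈ s, (c i • X i : Lp E p P) ω = c i • X i ω :=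
    (Finset.eventually_all s).2 fun i _ => Lp.coeFn_smul (c i) (X i)
  filter_upwards [Lp.coeFn_fun_finsetSum s fun i => c i • X i, hsmul] with ω hsum hω
  rw [hsum]
  exact Finset.sum_congr rfl hω

theorem continuous_integral_Lp_two [IsFiniteMeasure P] :
    Continuous fun X : Lp ℝ 2 P => ∫ ω, X ω ∂P := by
  have h (X : Lp ℝ 2 P) : ∫ ω, X ω ∂P =
      inner ℝ (indicatorConstLp 2 MeasurableSet.univ (measure_ne_top P _) (1 : ℝ)) X := by
    rw [L2.inner_indicatorConstLp_one, setIntegral_univ]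
  simp only [h]
  fun_prop

variable [IsProbabilityMeasure P]

theorem continuous_charFun_map_Lp {E : Type*} [NormedAddCommGroup E] [InnerProductSpace ℝ E]
    [FiniteDimensional ℝ E] [MeasurableSpace E] [BorelSpace E] {p : ℝ≥0∞} [Fact (1 ≤ p)] (x : E) :
    Continuous fun X : Lp E p P => charFun (P.map X) x := by
  refine continuous_iff_seqContinuous.2 fun X X₀ hX => ?_
  have hmeas (Y : Lp E p P) : AEMeasurable Y P := (Lp.aestronglyMeasurable Y).aemeasurable
  have hlaw := (tendstoInMeasure_of_tendsto_Lp hX).tendstoInDistribution fun n => hmeas (X n)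
  exact ProbabilityMeasure.tendsto_iff_tendsto_charFun.1 hlaw.tendsto x

theorem variance_Lp_two (X : Lp ℝ 2 P) : Var[X; P] = ‖X‖ ^ 2 - (∫ ω, X ω ∂P) ^ 2 := by
  rw [variance_eq_sub (Lp.memLp X), ← real_inner_self_eq_norm_sq, L2.inner_def]
  simp [sq]

theorem isClosed_setOf_hasGaussianLaw : IsClosed {X : Lp ℝ 2 P | HasGaussianLaw X P} := by
  have hiff (X : Lp ℝ 2 P) : HasGaussianLaw X P ↔ ∀ x : ℝ, charFun (P.map X) x =
      Complex.exp (((∫ ω, X ω ∂P) * x : ℝ) * Complex.I -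
        (x ^ 2 * (‖X‖ ^ 2 - (∫ ω, X ω ∂P) ^ 2) : ℝ) / 2) := by
    rw [hasGaussianLaw_iff_charFun_map_eq (Lp.aestronglyMeasurable X).aemeasurable]
    simp only [RCLike.inner_apply, conj_trivial, integral_mul_const, variance_mul_const,
      variance_Lp_two, mul_comm (_ ^ 2 - _)]
  simp only [hiff, Set.ofPred_forall]
  refine isClosed_iInter fun x => isClosed_eq (continuous_charFun_map_Lp x) ?_
  have := continuous_integral_Lp_two (P := P)
  fun_prop

end GaussianLimit

section Isonormal

variable {Ω H : Type*} {mΩ : MeasurableSpace Ω} {P : Measure Ω} [NormedAddCommGroup H]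
  [InnerProductSpace ℝ H]

/-- A continuous linear map `W : H → L²(P)` is isonormal if it is an isometry with values in the
centred Gaussian random variables; equivalently, `W` is a centred Gaussian process indexed by `H`
whose covariance is the inner product of `H`. -/
structure IsIsonormal (W : H →L[ℝ] Lp ℝ 2 P) : Prop where
  norm_map (h : H) : ‖W h‖ = ‖h‖
  hasGaussianLaw (h : H) : HasGaussianLaw (W h) P
  integral_eq_zero (h : H) : ∫ ω, W h ω ∂P = 0

namespace IsIsonormal

variable {W : H →L[ℝ] Lp ℝ 2 P}

theorem isProbabilityMeasure (hW : IsIsonormal W) : IsProbabilityMeasure P :=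
  (hW.hasGaussianLaw 0).isProbabilityMeasure

theorem inner_map_map (hW : IsIsonormal W) (g h : H) : inner ℝ (W g) (W h) = inner ℝ g h :=
  LinearIsometry.inner_map_map (⟨W.toLinearMap, hW.norm_map⟩ : H →ₗᵢ[ℝ] Lp ℝ 2 P) g h

theorem covariance_eq_inner (hW : IsIsonormal W) (g h : H) : cov[W g, W h; P] = inner ℝ g h := by
  have := hW.isProbabilityMeasure
  rw [covariance_eq_sub (Lp.memLp _) (Lp.memLp _), hW.integral_eq_zero, zero_mul, sub_zero,
    ← hW.inner_map_map, L2.inner_def]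
  simp [mul_comm]

theorem map_eq_gaussianReal (hW : IsIsonormal W) (h : H) :
    P.map (W h) = gaussianReal 0 (‖h‖₊ ^ 2) := by
  have := hW.isProbabilityMeasure
  rw [(hW.hasGaussianLaw h).map_eq_gaussianReal, hW.integral_eq_zero, variance_Lp_two,
    hW.integral_eq_zero, hW.norm_map]
  congr 1
  ext
  simp

theorem isGaussianProcess (hW : IsIsonormal W) : IsGaussianProcess (fun h => ⇑(W h)) P where
  hasGaussianLaw J := by
    have := hW.isProbabilityMeasure
    have hmeas : Measurable fun ω => J.restrict fun h => W h ω :=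
      measurable_pi_lambda _ fun h => (Lp.stronglyMeasurable _).measurable
    refine ⟨isGaussian_of_isGaussian_map fun L => ?_⟩
    rw [Measure.map_map (by fun_prop) hmeas]
    classical
    have hlin : L ∘ (fun ω => J.restrict fun h => W h ω) =ᵐ[P]
        W (∑ h : J, L (Pi.single h 1) • (h : H)) := by
      simp only [map_sum, map_smul]
      refine .trans (.of_eq (funext fun ω => ?_)) (coeFn_sum_smul_ae_eq _ _ _).symm
      rw [Function.comp_apply, pi_eq_sum_univ' (J.restrict fun h => W h ω), map_sum]
      refine Finset.sum_congr rfl fun h _ => ?_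
      rw [map_smul, smul_eq_mul, smul_eq_mul, mul_comm]
      rfl
    rw [Measure.map_congr hlin]
    exact (hW.hasGaussianLaw _).isGaussian_map

theorem indepFun_of_inner_eq_zero {S T : Type*} (hW : IsIsonormal W) {u : S → H} {v : T → H}
    (huv : ∀ s t, inner ℝ (u s) (v t) = 0) :
    IndepFun (fun ω s => W (u s) ω) (fun ω t => W (v t) ω) P := by
  have hmeas (h : H) : AEMeasurable (W h) P := (Lp.aestronglyMeasurable _).aemeasurable
  refine IsGaussianProcess.indepFun_of_covariance_eq_zero (X := fun s => ⇑(W (u s)))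
    (Y := fun t => ⇑(W (v t))) ?_ (fun s => hmeas _) (fun t => hmeas _) fun s t => by
      rw [hW.covariance_eq_inner, huv]
  have helim : Sum.elim (fun s => ⇑(W (u s))) (fun t => ⇑(W (v t))) =
      (fun h => ⇑(W h)) ∘ Sum.elim u v := by
    ext (s | t) <;> rfl
  rw [helim]
  exact hW.isGaussianProcess.comp_right _

variable (W) in
/-- The filtration generated by the random variables `W (φ 0), W (φ 1), …`. -/
noncomputable def filtration (φ : ℕ → H) : Filtration ℕ mΩ :=
  Filtration.natural (fun n => ⇑(W (φ n))) fun _ => Lp.stronglyMeasurable _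

theorem stronglyMeasurable_filtration (W : H →L[ℝ] Lp ℝ 2 P) (φ : ℕ → H) {n N : ℕ} (hn : n ≤ N) :
    StronglyMeasurable[filtration W φ N] (W (φ n)) :=
  (Filtration.stronglyAdapted_natural (u := fun n => ⇑(W (φ n)))
    fun _ => Lp.stronglyMeasurable _).stronglyMeasurable_le hn

theorem map_sum_inner_smul_ae_eq (W : H →L[ℝ] Lp ℝ 2 P) (φ : ℕ → H) (h : H) (N : ℕ) :
    W (∑ n ∈ Finset.range N, inner ℝ (φ n) h • φ n) =ᵐ[P]
      fun ω => ∑ n ∈ Finset.range N, inner ℝ (φ n) h * W (φ n) ω := by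
  simp only [map_sum, map_smul]
  exact coeFn_sum_smul_ae_eq _ _ _

theorem condExp_filtration_eq_zero (hW : IsIsonormal W) {φ : ℕ → H} {g : H} {N : ℕ}
    (hg : ∀ n ≤ N, inner ℝ (φ n) g = 0) : P[W g | filtration W φ N] =ᵐ[P] 0 := by
  have := hW.isProbabilityMeasure
  have hindep : IndepFun (W g) (fun ω (n : Set.Iic N) => W (φ n) ω) P :=
    (hW.indepFun_of_inner_eq_zero (u := fun _ : Unit => g) (v := fun n : Set.Iic N => φ n)
      fun _ n => by rw [real_inner_comm, hg n n.2]).comp (measurable_pi_apply ()) measurable_id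
  refine (condExp_indep_eq (m₁ := .comap (W g) inferInstance)
    (Lp.stronglyMeasurable _).measurable.comap_le ((filtration W φ).le N)
    (comap_measurable _).stronglyMeasurable ?_).trans ?_
  · rw [filtration, Filtration.natural_eq_comap]
    exact hindep
  · simp only [hW.integral_eq_zero]
    rfl

theorem condExp_filtration (hW : IsIsonormal W) {φ : ℕ → H} (hφ : Orthonormal ℝ φ) (h : H)
    (N : ℕ) : P[W h | filtration W φ N] =ᵐ[P]
      fun ω => ∑ n ∈ Finset.range (N + 1), inner ℝ (φ n) h * W (φ n) ω := by
  have := hW.isProbabilityMeasure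
  set proj : H := ∑ n ∈ Finset.range (N + 1), inner ℝ (φ n) h • φ n
  have hint (g : H) : Integrable (W g) P := (Lp.memLp (W g)).integrable one_le_two
  have hWproj := map_sum_inner_smul_ae_eq W φ h (N + 1)
  have hmeas : StronglyMeasurable[filtration W φ N]
      fun ω => ∑ n ∈ Finset.range (N + 1), inner ℝ (φ n) h * W (φ n) ω :=
    Finset.stronglyMeasurable_fun_sum _ fun n hn =>
      (stronglyMeasurable_filtration W φ (Finset.mem_range_succ_iff.1 hn)).const_mul _
  have horth (n : ℕ) (hn : n ≤ N) : inner ℝ (φ n) (h - proj) = 0 := by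
    rw [inner_sub_right, hφ.inner_right_sum _ (Finset.mem_range_succ_iff.2 hn), sub_self]
  have hsplit : W h =ᵐ[P] W proj + W (h - proj) := by
    filter_upwards [Lp.coeFn_sub (W h) (W proj)] with ω hω
    rw [map_sub, Pi.add_apply, hω, Pi.sub_apply, add_sub_cancel]
  calc P[W h | filtration W φ N] =ᵐ[P] P[W proj + W (h - proj) | filtration W φ N] :=
        condExp_congr_ae hsplit
    _ =ᵐ[P] P[W proj | filtration W φ N] + P[W (h - proj) | filtration W φ N] :=
        condExp_add (hint _) (hint _) _
    _ =ᵐ[P] P[W proj | filtration W φ N] := by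
        filter_upwards [hW.condExp_filtration_eq_zero horth] with ω hω
        rw [Pi.add_apply, hω, Pi.zero_apply, add_zero]
    _ =ᵐ[P] fun ω => ∑ n ∈ Finset.range (N + 1), inner ℝ (φ n) h * W (φ n) ω :=
        (condExp_congr_ae hWproj).trans (.of_eq (condExp_of_stronglyMeasurable
          ((filtration W φ).le N) hmeas ((hint proj).congr hWproj)))

theorem ae_tendsto_sum_inner_mul (hW : IsIsonormal W) (φ : HilbertBasis ℕ ℝ H) (h : H) :
    ∀ᵐ ω ∂P, Tendsto (fun N => ∑ n ∈ Finset.range N, inner ℝ (φ n) h * W (φ n) ω) atTop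
      (𝓝 (W h ω)) := by
  have := hW.isProbabilityMeasure
  have hcondExp := hW.condExp_filtration φ.orthonormal h
  have hWsum (N : ℕ) : W (∑ n ∈ Finset.range (N + 1), inner ℝ (φ n) h • φ n) =ᵐ[P]
      P[W h | filtration W φ N] :=
    (map_sum_inner_smul_ae_eq W φ h (N + 1)).trans (hcondExp N).symm
  have hlevy := tendsto_ae_condExp (ℱ := filtration W φ) (μ := P) (W h)
  have hL2 : Tendsto (fun N => ∑ n ∈ Finset.range (N + 1), inner ℝ (φ n) h • φ n) atTop (𝓝 h) := by
    have hsum := (φ.hasSum_repr h).tendsto_sum_nat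
    simp only [φ.repr_apply_apply] at hsum
    exact hsum.comp (tendsto_add_atTop_nat 1)
  have hmeasure : TendstoInMeasure P (fun N => P[W h | filtration W φ N]) atTop (W h) :=
    .congr_left hWsum (tendstoInMeasure_of_tendsto_Lp ((W.continuous.tendsto h).comp hL2))
  -- Lévy's upward theorem gives some almost sure limit; convergence in `L²` identifies it as `W h`.
  have hlimit := tendstoInMeasure_ae_unique (tendstoInMeasure_of_tendsto_ae
    (fun N => integrable_condExp.aestronglyMeasurable) hlevy) hmeasure
  filter_upwards [hlevy, hlimit, ae_all_iff.2 hcondExp] with ω hω hlim hsum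
  simp only [hsum, hlim] at hω
  exact (tendsto_add_atTop_iff_nat 1).1 hω

end IsIsonormal

end Isonormal

/-! ### Orthonormal expansions of Hölder continuous Gaussian processes -/

section Expansion

variable {Ω H T : Type*} {mΩ : MeasurableSpace Ω} {P : Measure Ω} [NormedAddCommGroup H]
  [InnerProductSpace ℝ H] {W : H →L[ℝ] Lp ℝ 2 P} {a r C : ℝ≥0}

namespace IsIsonormal

theorem lintegral_enorm_rpow (hW : IsIsonormal W) {p : ℝ} (hp : 0 ≤ p) (h : H) :
    ∫⁻ ω, ‖W h ω‖ₑ ^ p ∂P = ‖h‖ₑ ^ p * ∫⁻ x, ‖x‖ₑ ^ p ∂gaussianReal 0 1 := by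
  have hscale : gaussianReal 0 (‖h‖₊ ^ 2) = (gaussianReal 0 1).map (‖h‖ * ·) := by
    rw [gaussianReal_map_const_mul]
    congr 1
    · simp
    · ext; simp
  have hpow : Measurable fun x : ℝ => ‖x‖ₑ ^ p := by fun_prop
  rw [← lintegral_map hpow (Lp.stronglyMeasurable (W h)).measurable, hW.map_eq_gaussianReal,
    hscale, lintegral_map hpow (by fun_prop), ← lintegral_const_mul _ hpow]
  simp only [enorm_mul, enorm_norm, ENNReal.mul_rpow_of_nonneg _ _ hp]

theorem exists_isKolmogorovProcess [PseudoEMetricSpace T] (hW : IsIsonormal W) {u : T → H}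
    (hu : HolderWith C a u) (ha : 0 < a) {p : ℝ} (hp : 0 < p) :
    ∃ M, IsKolmogorovProcess (fun t => ⇑(W (u t))) P p (a * p) M := by
  set G : ℝ≥0∞ := ∫⁻ x, ‖x‖ₑ ^ p ∂gaussianReal 0 1
  have hG : G ≠ ∞ := by
    have h := (memLp_id_gaussianReal' (μ := 0) (v := 1) (ENNReal.ofReal p)
      ENNReal.ofReal_ne_top).eLpNorm_lt_top
    rw [eLpNorm_lt_top_iff_lintegral_rpow_enorm_lt_top (by simpa using hp)
      ENNReal.ofReal_ne_top, ENNReal.toReal_ofReal hp.le] at h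
    exact h.ne
  refine ⟨C ^ p * G.toNNReal, .mk_of_secondCountableTopology
    (fun t => (Lp.stronglyMeasurable _).measurable) (fun s t => ?_) hp (by positivity)⟩
  have hedist : ∀ᵐ ω ∂P, edist (W (u s) ω) (W (u t) ω) = ‖W (u s - u t) ω‖ₑ := by
    filter_upwards [Lp.coeFn_sub (W (u s)) (W (u t))] with ω hω
    rw [edist_eq_enorm_sub, map_sub, hω, Pi.sub_apply]
  calc ∫⁻ ω, edist (W (u s) ω) (W (u t) ω) ^ p ∂P
      = edist (u s) (u t) ^ p * G := by
        rw [lintegral_congr_ae (hedist.mono fun ω hω => congrArg (· ^ p) hω),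
          hW.lintegral_enorm_rpow hp.le, edist_eq_enorm_sub]
    _ ≤ (C * edist s t ^ (a : ℝ)) ^ p * G := by
        gcongr
        exact hu s t
    _ = ↑(C ^ p * G.toNNReal) * edist s t ^ (a * p) := by
        rw [ENNReal.mul_rpow_of_nonneg _ _ hp.le, ← ENNReal.rpow_mul, ENNReal.coe_mul,
          ENNReal.coe_rpow_of_nonneg _ hp.le, ENNReal.coe_toNNReal hG, mul_right_comm]

variable {Y : I → Ω → ℝ} {u : I → H}

theorem exists_integrable_holderWith (hW : IsIsonormal W) (hu : HolderWith C a u)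
    (hY : ∀ t, Y t =ᵐ[P] W (u t)) (hcont : ∀ᵐ ω ∂P, Continuous (Y · ω)) (hr : 0 < r)
    (hra : r < a) :
    ∃ K : Ω → ℝ≥0, Integrable (fun ω => (K ω : ℝ)) P ∧ ∀ᵐ ω ∂P, HolderWith (K ω) r (Y · ω) := by
  have := hW.isProbabilityMeasure
  have hgap : (0 : ℝ) < a - r := sub_pos.2 hra
  set p : ℝ := 1 + 1 / (a - r)
  have hp : 1 ≤ p := le_add_of_nonneg_right (by positivity)
  have hrp : 1 + r * p < a * p := by
    have : (a - r) * p = (a - r) + 1 := by rw [mul_add, mul_one_div_cancel hgap.ne', mul_one]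
    linarith
  obtain ⟨M, hM⟩ := hW.exists_isKolmogorovProcess hu (hr.trans hra) (zero_lt_one.trans_le hp)
  obtain ⟨K, hK, hYK⟩ := exists_memLp_holderWith_of_kolmogorov
    (hM.IsAEKolmogorovProcess.congr fun t => (hY t).symm) hcont hr hrp
  exact ⟨K, hK.integrable (by simpa using hp), hYK⟩

theorem ae_exists_forall_holderWith_sum_inner_mul (hW : IsIsonormal W) (hu : HolderWith C a u)
    (hY : ∀ t, Y t =ᵐ[P] W (u t)) (hcont : ∀ᵐ ω ∂P, Continuous (Y · ω)) {φ : ℕ → H}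
    (hφ : Orthonormal ℝ φ) (hr : 0 < r) (hra : r < a) :
    ∀ᵐ ω ∂P, ∃ C : ℝ≥0, ∀ N, HolderWith C r
      fun t => ∑ n ∈ Finset.range N, inner ℝ (φ n) (u t) * W (φ n) ω := by
  have := hW.isProbabilityMeasure
  obtain ⟨K, hK, hYK⟩ := hW.exists_integrable_holderWith hu hY hcont hr hra
  have hint (t : I) : Integrable (Y t) P :=
    ((Lp.memLp (W (u t))).integrable one_le_two).congr (hY t).symm
  have hcondExp (N : ℕ) (t : I) :
      (fun ω => ∑ n ∈ Finset.range (N + 1), inner ℝ (φ n) (u t) * W (φ n) ω) =ᵐ[P]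
        P[Y t | filtration W φ N] :=
    (hW.condExp_filtration hφ (u t) N).symm.trans (condExp_congr_ae (hY t).symm)
  have hsum_cont (ω : Ω) (N : ℕ) :
      Continuous fun t => ∑ n ∈ Finset.range (N + 1), inner ℝ (φ n) (u t) * W (φ n) ω := by
    have := hu.continuous (hr.trans hra)
    fun_prop
  filter_upwards [ae_exists_forall_holderWith_of_condExp hint hK hYK hcondExp
    (ae_of_all P hsum_cont)] with ω ⟨D, hD⟩
  refine ⟨D, fun N => ?_⟩
  cases N with
  | zero =>
    simp only [Finset.range_zero, Finset.sum_empty]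
    exact .const
  | succ N => exact hD N

theorem ae_tendstoHolder_sum_inner_mul (hW : IsIsonormal W) (hu : HolderWith C a u)
    (hY : ∀ t, Y t =ᵐ[P] W (u t)) (hcont : ∀ᵐ ω ∂P, Continuous (Y · ω))
    (φ : HilbertBasis ℕ ℝ H) :
    ∀ᵐ ω ∂P, ∀ s < a, TendstoHolder s
      (fun N t => ∑ n ∈ Finset.range N, inner ℝ (φ n) (u t) * W (φ n) ω) (Y · ω) := by
  obtain ⟨S, hScount, hSdense⟩ := TopologicalSpace.exists_countable_dense I
  have hlim : ∀ᵐ ω ∂P, ∀ t ∈ S, Tendsto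
      (fun N => ∑ n ∈ Finset.range N, inner ℝ (φ n) (u t) * W (φ n) ω) atTop (𝓝 (Y t ω)) := by
    refine (ae_ball_iff hScount).2 fun t _ => ?_
    filter_upwards [hW.ae_tendsto_sum_inner_mul φ (u t), hY t] with ω hω hYω
    rwa [hYω]
  obtain ⟨R, hRcount, hRdense⟩ := TopologicalSpace.exists_countable_dense ℝ≥0
  have hholder : ∀ᵐ ω ∂P, ∀ r ∈ R ∩ Set.Ioo 0 a, ∃ D : ℝ≥0, ∀ N, HolderWith D r
      fun t => ∑ n ∈ Finset.range N, inner ℝ (φ n) (u t) * W (φ n) ω :=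
    (ae_ball_iff (hRcount.mono Set.inter_subset_left)).2 fun r hr =>
      hW.ae_exists_forall_holderWith_sum_inner_mul hu hY hcont φ.orthonormal hr.2.1 hr.2.2
  filter_upwards [hcont, hlim, hholder] with ω hω hlimω hholderω s hs
  obtain ⟨r, hrR, hsr, hra⟩ := hRdense.exists_between hs
  obtain ⟨D, hD⟩ := hholderω r ⟨hrR, pos_of_gt hsr, hra⟩
  exact tendstoHolder_of_holderWith hSdense hD hsr hω hlimω

end IsIsonormal

end Expansion

/-! ### Bifractional Brownian motion as an isonormal map -/

theorem rpow_add_rpow_le_two_rpow_mul {a b β : ℝ} (ha : 0 ≤ a) (hb : 0 ≤ b) (hβ : 0 ≤ β)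
    (hβ1 : β ≤ 1) : a ^ β + b ^ β ≤ 2 * (1 / (2 : ℝ) ^ β * (a + b) ^ β) := by
  have h := (Real.concaveOn_rpow hβ hβ1).2 (Set.mem_Ici.2 ha) (Set.mem_Ici.2 hb)
    (by norm_num : (0 : ℝ) ≤ 1 / 2) (by norm_num : (0 : ℝ) ≤ 1 / 2) (by norm_num)
  simp only [smul_eq_mul] at h
  rw [← mul_add, ← mul_add, Real.mul_rpow (by norm_num) (by positivity),
    Real.div_rpow (by norm_num) (by norm_num), Real.one_rpow] at h
  linarith

theorem bifractionalKernel_self {α β : ℝ} (h : α * β ≠ 0) (t : I) :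
    bifractionalKernel α β t t = (t : ℝ) ^ (2 * α * β) := by
  have ht : 0 ≤ (t : ℝ) := t.2.1
  have h' : 2 * α * β ≠ 0 := by rw [mul_assoc]; exact mul_ne_zero two_ne_zero h
  rw [bifractionalKernel, sub_self, abs_zero, Real.zero_rpow h', sub_zero, ← two_mul,
    Real.mul_rpow (by norm_num) (by positivity), ← Real.rpow_mul ht, ← mul_assoc, one_div,
    inv_mul_cancel₀ (by positivity), one_mul]

namespace BifractionalHilbert

variable {α β : ℝ} (hR : (bifractionalKernel α β).PosSemidef)

theorem inner_ind (s t : I) : inner ℝ (ind hR s) (ind hR t) = bifractionalKernel α β s t := by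
  rw [ind, ind, UniformSpace.Completion.inner_coe, StepSpace.inner_ind]

theorem norm_ind_sub_sq_le (hα : 0 < α) (hβ : 0 < β) (hβ1 : β ≤ 1) (s t : I) :
    ‖ind hR s - ind hR t‖ ^ 2 ≤ 2 * |(s : ℝ) - t| ^ (2 * α * β) := by
  have hαβ : α * β ≠ 0 := (mul_pos hα hβ).ne'
  have hs : 0 ≤ (s : ℝ) := s.2.1
  have ht : 0 ≤ (t : ℝ) := t.2.1
  have hdiag : (s : ℝ) ^ (2 * α * β) + (t : ℝ) ^ (2 * α * β) ≤
      2 * (1 / (2 : ℝ) ^ β * ((t : ℝ) ^ (2 * α) + (s : ℝ) ^ (2 * α)) ^ β) := by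
    rw [Real.rpow_mul hs, Real.rpow_mul ht, add_comm]
    exact rpow_add_rpow_le_two_rpow_mul (by positivity) (by positivity) hβ.le hβ1
  have hoff : 1 / (2 : ℝ) ^ β * |(t : ℝ) - s| ^ (2 * α * β) ≤ |(t : ℝ) - s| ^ (2 * α * β) :=
    mul_le_of_le_one_left (by positivity)
      ((div_le_one (by positivity)).2 (Real.one_le_rpow one_le_two hβ.le))
  rw [abs_sub_comm, norm_sub_sq_real, ← real_inner_self_eq_norm_sq, ← real_inner_self_eq_norm_sq,
    inner_ind, inner_ind, inner_ind, bifractionalKernel_self hαβ, bifractionalKernel_self hαβ,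
    bifractionalKernel, mul_sub (1 / (2 : ℝ) ^ β)]
  linarith

theorem holderWith_ind (hα : 0 < α) (hβ : 0 < β) (hβ1 : β ≤ 1) :
    HolderWith (NNReal.sqrt 2) (α * β).toNNReal (ind hR) := by
  intro s t
  have hαβ : 0 < α * β := mul_pos hα hβ
  have hdist : dist (ind hR s) (ind hR t) ≤ √2 * dist s t ^ (α * β) := by
    refine le_of_sq_le_sq ?_ (by positivity)
    rw [mul_pow, Real.sq_sqrt zero_le_two, ← Real.rpow_mul_natCast dist_nonneg, dist_eq_norm]
    refine (norm_ind_sub_sq_le hR hα hβ hβ1 s t).trans_eq ?_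
    rw [Subtype.dist_eq, Real.dist_eq, Nat.cast_ofNat, mul_comm (α * β), mul_assoc]
  rw [edist_dist, edist_dist, Real.coe_toNNReal _ hαβ.le,
    ENNReal.ofReal_rpow_of_nonneg dist_nonneg hαβ.le, ← ENNReal.ofReal_coe_nnreal,
    ← ENNReal.ofReal_mul (by positivity), Real.coe_sqrt, NNReal.coe_ofNat]
  exact ENNReal.ofReal_le_ofReal hdist

end BifractionalHilbert

namespace IsBifractionalBrownianMotion

variable {Ω : Type*} [MeasurableSpace Ω] {α β : ℝ} {B : I → Ω → ℝ} {P : Measure Ω}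

theorem stepIntegral_ae_eq (hB : IsBifractionalBrownianMotion α β B P)
    (f : StepSpace (bifractionalKernel α β) hB.posSemidef) :
    hB.stepIntegral f =ᵐ[P] fun ω =>
      ((StepSpace.basis _ hB.posSemidef).repr f).sum fun t a => a • B t ω := by
  set c := (StepSpace.basis _ hB.posSemidef).repr f
  have hB_ae : ∀ᵐ ω ∂P, ∀ t ∈ c.support, (hB.memLp t).toLp (B t) ω = B t ω :=
    (Finset.eventually_all _).2 fun t _ => (hB.memLp t).coeFn_toLp
  rw [stepIntegral, Module.Basis.constr_apply]
  filter_upwards [coeFn_sum_smul_ae_eq c.support c fun t => (hB.memLp t).toLp (B t), hB_ae]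
    with ω hsum hω
  exact hsum.trans (Finset.sum_congr rfl fun t ht => by rw [hω t ht])

theorem integral_stepIntegral (hB : IsBifractionalBrownianMotion α β B P)
    (f : StepSpace (bifractionalKernel α β) hB.posSemidef) :
    ∫ ω, hB.stepIntegral f ω ∂P = 0 := by
  have := hB.isGaussianProcess.isProbabilityMeasure
  have hint (t : I) : Integrable (B t) P := (hB.memLp t).integrable one_le_two
  rw [integral_congr_ae (hB.stepIntegral_ae_eq f)]
  simp only [Finsupp.sum]
  rw [integral_finsetSum _ fun t _ => (hint t).fun_smul _]
  simp only [integral_smul, hB.centred, smul_zero, Finset.sum_const_zero]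

theorem hasGaussianLaw_stepIntegral (hB : IsBifractionalBrownianMotion α β B P)
    (f : StepSpace (bifractionalKernel α β) hB.posSemidef) :
    HasGaussianLaw (hB.stepIntegral f) P :=
  (hB.isGaussianProcess.smul _).hasGaussianLaw_fun_sum.congr (hB.stepIntegral_ae_eq f).symm

theorem isIsonormal_wienerIntegral (hB : IsBifractionalBrownianMotion α β B P) :
    IsIsonormal hB.wienerIntegral where
  norm_map := hB.norm_wienerIntegral
  hasGaussianLaw h := by
    have := hB.isGaussianProcess.isProbabilityMeasure
    refine UniformSpace.Completion.induction_on h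
      (isClosed_setOf_hasGaussianLaw.preimage hB.wienerIntegral.continuous) fun f => ?_
    rw [wienerIntegral_coe]
    exact hB.hasGaussianLaw_stepIntegral f
  integral_eq_zero h := by
    have := hB.isGaussianProcess.isProbabilityMeasure
    refine UniformSpace.Completion.induction_on h (isClosed_eq
      (continuous_integral_Lp_two.comp hB.wienerIntegral.continuous) continuous_const) fun f => ?_
    rw [wienerIntegral_coe]
    exact hB.integral_stepIntegral f

end IsBifractionalBrownianMotion

theorem mainTheorem3_general {Ω : Type*} [MeasurableSpace Ω] {P : Measure Ω} {α β : ℝ}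
    (hα : 0 < α) (hβ : 0 < β) (hβ1 : β ≤ 1) {B : I → Ω → ℝ}
    (hB : IsBifractionalBrownianMotion α β B P) (hcont : ∀ᵐ ω ∂P, Continuous fun t => B t ω)
    (φ : HilbertBasis ℕ ℝ hB.H) :
    ∀ᵐ ω ∂P, ∀ γ : ℝ≥0, (γ : ℝ) < α * β →
      TendstoHolder γ (fun N => hB.partialSum φ N ω) (fun t => B t ω) := by
  have hind := BifractionalHilbert.holderWith_ind hB.posSemidef hα hβ hβ1
  have hBind (t : I) : B t =ᵐ[P] hB.wienerIntegral (hB.ind t) := by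
    rw [hB.wienerIntegral_ind]
    exact (hB.memLp t).coeFn_toLp.symm
  filter_upwards [hB.isIsonormal_wienerIntegral.ae_tendstoHolder_sum_inner_mul hind hBind hcont φ]
    with ω hω γ hγ
  exact hω γ (Real.lt_toNNReal_iff_coe_lt.2 hγ)

theorem mainTheorem3 {Ω : Type*} [MeasurableSpace Ω] (P : Measure Ω) [IsProbabilityMeasure P]
    (α β : ℝ) (hα : 0 < α ∧ α < 1) (hβ : 0 < β ∧ β ≤ 1) (hαβ : 1 / 2 < α * β)
    (B : I → Ω → ℝ) (hB : IsBifractionalBrownianMotion α β B P)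
    (hcont : ∀ᵐ ω ∂P, Continuous fun t => B t ω)
    (φ : HilbertBasis ℕ ℝ hB.H) :
    ∀ᵐ ω ∂P, ∀ γ : ℝ≥0, 0 < γ → (γ : ℝ) < α * β →
      TendstoHolder γ (fun N => hB.partialSum φ N ω) (fun t => B t ω) :=
  (mainTheorem3_general hα.1 hβ.1 hβ.2 hB hcont φ).mono fun _ hω γ _ => hω γ
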